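/- Let $m,q,k\ge 1$ be integers and let $\Omega$ be an alphabet with $q$ letters. A cyclic sequence over $\Omega$ is a finite sequence considered up to rotation; each of the rotations is called a linearization of it. A cyclic multi de Bruijn sequence is a cyclic sequence in which every $k$-mer $z\in\Omega^k$ occurs at exactly $m$ starting positions, where occurrences may overlap and are read cyclically (wrapping around the end, more than once if $k$ exceeds the length of the sequence). For $y\in\Omega^k$ let $\mathcal{LC}_y(m,q,k)$ be the set of linearizations of cyclic multi de Bruijn sequences that start with $y$, i.e. in which $y$ occurs (read cyclically) at the first position. Then, for every $y\in\Omega^k$, the set $\mathcal{LC}_y(m,q,k)$ is finite and $$|\mathcal{LC}_y(m,q,k)|=\frac{W(m,q,k)}{q^k},\qquad\text{where}\qquad W(m,q,k)=\left(\frac{(mq)!}{m!^{\,q}}\right)^{q^{k-1}}.$$ -/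

import Mathlib

namespace MultiDeBruijn

variable {Ω : Type*}

/-- The `k`-mer of the linear sequence `s` starting at position `i` and read cyclically
(wrapping around the end, several times if `k` exceeds the length of `s`). -/
def cyclicKmer (s : List Ω) (k : ℕ) (i : Fin s.length) : Fin k → Ω :=
  fun j => s[(i.val + j.val) % s.length]'(Nat.mod_lt _ i.pos)

/-- The number of starting positions in `s` at which the `k`-mer `y` occurs cyclically. -/
def listCount [DecidableEq Ω] {k : ℕ} (y : Fin k → Ω) (s : List Ω) : ℕ :=
  (Finset.univ.filter fun i : Fin s.length => cyclicKmer s k i = y).card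

/-- The number of cyclic occurrences of `y` does not change under rotation. -/
theorem listCount_eq_of_isRotated [DecidableEq Ω] {k : ℕ} (y : Fin k → Ω) {s t : List Ω}
    (h : s ~r t) : listCount y s = listCount y t := by
  obtain ⟨n, rfl⟩ := h
  unfold listCount
  symm
  have hlen : (s.rotate n).length = s.length := List.length_rotate ..
  refine Finset.card_bij
    (fun i _ => ⟨(i.val + n) % s.length, Nat.mod_lt _ (hlen ▸ i.pos)⟩) ?_ ?_ ?_
  · intro i hi
    simp only [Finset.mem_filter, Finset.mem_univ, true_and] at hi ⊢
    rw [← hi]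
    funext j
    simp only [cyclicKmer, List.getElem_rotate, List.length_rotate]
    congr 1
    simp only [Nat.mod_add_mod]
    congr 1
    omega
  · intro i _ i' _ h
    have h1 : i.val + n ≡ i'.val + n [MOD s.length] := by
      simpa [Nat.ModEq] using h
    have h2 := Nat.ModEq.add_right_cancel' n h1
    apply Fin.ext
    exact Nat.ModEq.eq_of_lt_of_lt h2 (hlen ▸ i.isLt) (hlen ▸ i'.isLt)
  · intro j hj
    have hpos : 0 < s.length := j.pos
    have key : ((j.val + (s.length - n % s.length)) % s.length + n) % s.length = j.val := by
      have hn : n % s.length < s.length := Nat.mod_lt _ hpos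
      rw [Nat.mod_add_mod, Nat.add_mod, ← Nat.mod_mod n, ← Nat.add_mod, Nat.mod_mod,
        show j.val + (s.length - n % s.length) + n % s.length = j.val + s.length by omega,
        Nat.add_mod_right, Nat.mod_eq_of_lt j.isLt]
    refine ⟨⟨(j.val + (s.length - n % s.length)) % s.length,
      hlen.symm ▸ Nat.mod_lt _ hpos⟩, ?_, Fin.ext key⟩
    simp only [Finset.mem_filter, Finset.mem_univ, true_and] at hj ⊢
    rw [← hj]
    funext l
    simp only [cyclicKmer, List.getElem_rotate, List.length_rotate]
    congr 1
    conv_rhs => rw [← key]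
    simp only [Nat.mod_add_mod]
    congr 1
    omega

/-- The number of occurrences of the `k`-mer `y` in a cyclic sequence. -/
def cycleCount [DecidableEq Ω] {k : ℕ} (y : Fin k → Ω) (c : Cycle Ω) : ℕ :=
  Quotient.liftOn' c (listCount y) fun _ _ h => listCount_eq_of_isRotated y h

/-- The cyclic multi de Bruijn sequences over `Ω`: every `k`-mer occurs exactly `m` times. -/
def cyclicSeqs (Ω : Type*) [DecidableEq Ω] (m k : ℕ) : Set (Cycle Ω) :=
  {c | ∀ y : Fin k → Ω, cycleCount y c = m}

/-- The linearizations of the cyclic multi de Bruijn sequences. -/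
def linearizedSeqs (Ω : Type*) [DecidableEq Ω] (m k : ℕ) : Set (List Ω) :=
  {s | ∃ c ∈ cyclicSeqs Ω m k, (s : Cycle Ω) = c}

/-- `s` starts with the `k`-mer `y`, i.e. `y` occurs (cyclically) at the first position of `s`.
If `k ≤ s.length` then this says that `y` is a prefix of `s`. -/
def StartsWith {k : ℕ} (s : List Ω) (y : Fin k → Ω) : Prop :=
  ∃ h : 0 < s.length, cyclicKmer s k ⟨0, h⟩ = y

/-- The linearizations of cyclic multi de Bruijn sequences that start with the `k`-mer `y`. -/
def linearizedSeqsFrom [DecidableEq Ω] (m k : ℕ) (y : Fin k → Ω) : Set (List Ω) :=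
  {s | s ∈ linearizedSeqs Ω m k ∧ StartsWith s y}

/-- `W(m,q,k) = ((mq)! / m!^q)^(q^(k-1))`, for `k ≥ 1`. -/
def W (m q k : ℕ) : ℚ :=
  (((m * q).factorial : ℚ) / (m.factorial : ℚ) ^ q) ^ q ^ (k - 1)

end MultiDeBruijn

/-! Put `n = k - 1`, `q = |Ω|`, and let `V = Fin n → Ω` be the states of the de Bruijn automaton
`shift`. If `r` is the `n`-mer at the start of a linearization `t`, then `t.rotate n`, read from
`r`, traverses one transition for each starting position of a `k`-mer. So `t` is multi de Bruijn
exactly when this word uses every transition `m` times, i.e. is an Eulerian circuit at `r` with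
indistinguishable parallel edges.

Such circuits are counted as in the BEST theorem. Record at each state the letters by which it is
left, in order. Each resulting stack contains every letter `m` times, and a family of such stacks
comes from a circuit at `r` iff following last exits leads every state to `r`
(`card_balancedWords_eq`). Last letters of stacks are equidistributed, so the proportion of good
families is the proportion of selections `f : V → Ω` that lead all states to `r`. A matrix-tree
expansion makes this proportion the determinant of `1 - P` with row `r` replaced by a unit vector,
`P` being the transition matrix of the uniform random walk. As `P` is doubly stochastic and `n`
letters erase the initial state, the determinant is `1 / |V|` (`card_mul_det_updateRow`).

With `M = (mq)! / m!^q` possible stacks per state, each `r` therefore has `M ^ |V| / |V|` circuits,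
and summing over `r` gives `M ^ |V| = W` linearizations. Double counting pairs (linearization,
position of `y`) then yields the factor `1 / q ^ k`. -/

namespace MultiDeBruijn

/-! ### Words with prescribed letter counts -/

section Words

variable {Ω : Type*} [DecidableEq Ω]

/-- The words in which every letter `a` occurs exactly `c a` times. -/
def wordsWithContent (c : Ω → ℕ) : Set (List Ω) := {l | ∀ a, l.count a = c a}

theorem length_eq_sum_count [Fintype Ω] (l : List Ω) : l.length = ∑ a, l.count a := by
  simpa using (Multiset.sum_count_eq_card (s := Finset.univ) (m := (l : Multiset Ω)) (by simp)).symm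

theorem finite_wordsWithContent [Fintype Ω] (c : Ω → ℕ) : (wordsWithContent c).Finite := by
  refine (List.finite_length_eq Ω (∑ a, c a)).subset fun l hl => ?_
  simp only [Set.mem_ofPred_eq, length_eq_sum_count]
  exact Finset.sum_congr rfl fun a _ => hl a

/-- A nonempty word is determined by its first letter and the remaining word. -/
def wordsWithContentEquivSigma (c : Ω → ℕ) (hc : c ≠ 0) :
    wordsWithContent c ≃
      Σ a : {a // c a ≠ 0}, wordsWithContent (Function.update c a.1 (c a.1 - 1)) where
  toFun l := match l with
    | ⟨[], h⟩ => absurd (funext fun a => by simpa using (h a).symm) hc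
    | ⟨a :: l, h⟩ => ⟨⟨a, by rw [← h a]; simp⟩, l, fun b => by
        have h1 := h a
        have h2 := h b
        by_cases hb : b = a
        · subst hb; simp at h1 ⊢; omega
        · simp [Function.update_of_ne hb, ← h2, List.count_cons_of_ne (Ne.symm hb)]⟩
  invFun p := ⟨p.1.1 :: p.2.1, fun b => by
    obtain ⟨⟨a, ha⟩, l, hl⟩ := p
    have h2 := hl b
    by_cases hb : b = a
    · subst hb; simp at h2 ⊢; omega
    · simpa [Function.update_of_ne hb, List.count_cons_of_ne (Ne.symm hb)] using h2⟩
  left_inv l := match l with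
    | ⟨[], h⟩ => absurd (funext fun a => by simpa using (h a).symm) hc
    | ⟨a :: l, h⟩ => rfl
  right_inv p := rfl

/-- The number of words with given content is a multinomial coefficient. -/
theorem card_wordsWithContent_mul [Fintype Ω] (c : Ω → ℕ) :
    Nat.card (wordsWithContent c) * ∏ a, (c a).factorial = (∑ a, c a).factorial := by
  induction hN : ∑ a, c a generalizing c with
  | zero =>
    have hc : c = 0 := by
      funext a
      exact (Finset.sum_eq_zero_iff.1 hN) a (Finset.mem_univ a)
    subst hc
    have : wordsWithContent (0 : Ω → ℕ) = {[]} := by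
      ext l
      simp only [wordsWithContent, Pi.zero_apply, Set.mem_ofPred_eq, Set.mem_singleton_iff]
      refine ⟨fun h => ?_, fun h => by simp [h]⟩
      exact List.eq_nil_iff_forall_not_mem.2 fun a => List.count_eq_zero.1 (h a)
    simp [this]
  | succ N ih =>
    have hc : c ≠ 0 := by rintro rfl; simp at hN
    have hfin : ∀ c : Ω → ℕ, Finite (wordsWithContent c) := fun c => finite_wordsWithContent c
    rw [Nat.card_congr (wordsWithContentEquivSigma c hc), Nat.card_sigma, Finset.sum_mul]
    -- Removing one `a` divides the product of factorials by `c a`, so the words beginning with `a`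
    -- contribute `c a * N!`; these sum to `(N + 1)!`.
    have key : ∀ a : {a // c a ≠ 0},
        Nat.card (wordsWithContent (Function.update c a.1 (c a.1 - 1))) * ∏ b, (c b).factorial
          = c a.1 * N.factorial := by
      rintro ⟨a, ha⟩
      have h1 : ∏ b, (c b).factorial
          = c a * ∏ b, (Function.update c a (c a - 1) b).factorial := by
        rw [← Finset.mul_prod_erase _ _ (Finset.mem_univ a),
          ← Finset.mul_prod_erase _ (fun b => (Function.update c a (c a - 1) b).factorial)
            (Finset.mem_univ a), ← mul_assoc, Function.update_self,
          Nat.mul_factorial_pred ha]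
        congr 1
        refine Finset.prod_congr rfl fun b hb => ?_
        rw [Function.update_of_ne (Finset.ne_of_mem_erase hb)]
      have h2 : ∑ b, Function.update c a (c a - 1) b = N := by
        have h3 := Finset.add_sum_erase Finset.univ c (Finset.mem_univ a)
        have h4 : ∑ b ∈ Finset.univ.erase a, Function.update c a (c a - 1) b =
            ∑ b ∈ Finset.univ.erase a, c b := Finset.sum_congr rfl fun b hb =>
          Function.update_of_ne (Finset.ne_of_mem_erase hb) (c a - 1) c
        rw [← Finset.add_sum_erase _ _ (Finset.mem_univ a), h4, Function.update_self]
        omega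
      rw [h1, mul_left_comm, ih _ h2]
    rw [Finset.sum_congr rfl fun a _ => key a, ← Finset.sum_mul, Nat.factorial_succ, ← hN]
    congr 1
    exact (Finset.sum_subtype (p := fun a => c a ≠ 0) (Finset.univ.filter fun a => c a ≠ 0)
      (fun a => by simp) c).symm.trans (Finset.sum_filter_ne_zero _)

theorem getLast?_eq_of_mem_wordsWithContent {m : ℕ} (hm : 1 ≤ m) (b : Ω) {l : List Ω}
    (hl : l ∈ wordsWithContent fun _ : Ω => m) : ∃ a, l.getLast? = some a := by
  rcases List.eq_nil_or_concat' l with rfl | ⟨l, a, rfl⟩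
  · have := hl b
    simp at this
    omega
  · exact ⟨a, by simp⟩

/-- The last letter of a word with constant content is equidistributed. -/
theorem card_getLast?_eq_card_getLast? (m : ℕ) (a b : Ω) :
    Nat.card {l : wordsWithContent fun _ : Ω => m // l.1.getLast? = some a} =
      Nat.card {l : wordsWithContent fun _ : Ω => m // l.1.getLast? = some b} := by
  -- Swapping `a` and `b` throughout a word is an involution that preserves constant content and
  -- exchanges the two possible last letters.
  have key : ∀ (l : List Ω) (x : Ω), (l.map (Equiv.swap a b)).count x = l.count (Equiv.swap a b x) :=
    fun l x => by
      conv_lhs => rw [← Equiv.swap_apply_self a b x]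
      exact List.count_map_of_injective _ _ (Equiv.swap a b).injective _
  have hinv : ∀ l : List Ω, (l.map (Equiv.swap a b)).map (Equiv.swap a b) = l := fun l => by
    simp [Function.comp_def]
  refine Nat.card_congr
    { toFun := fun l => ⟨⟨l.1.1.map (Equiv.swap a b), fun x => ?_⟩, ?_⟩
      invFun := fun l => ⟨⟨l.1.1.map (Equiv.swap a b), fun x => ?_⟩, ?_⟩
      left_inv := fun l => Subtype.ext (Subtype.ext (hinv _))
      right_inv := fun l => Subtype.ext (Subtype.ext (hinv _)) }
  · rw [key]; exact l.1.2 _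
  · simp [List.getLast?_map, l.2]
  · rw [key]; exact l.1.2 _
  · simp [List.getLast?_map, l.2]

end Words

/-- If all fibres of `last : X → Ω` have the same size, then the number of functions `τ : V → X`
such that `last ∘ τ` satisfies `P` is proportional to the number of functions satisfying `P`. -/
theorem card_comp_mul_pow {V Ω X : Type*} [Fintype V] [Fintype Ω] [Finite X] [DecidableEq Ω]
    (last : X → Ω) (c : ℕ) (hc : ∀ a, Nat.card {x // last x = a} = c) (P : (V → Ω) → Prop) :
    Nat.card {τ : V → X // P (last ∘ τ)} = Nat.card {f // P f} * c ^ Fintype.card V := by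
  have e : {τ : V → X // P (last ∘ τ)} ≃ Σ f : {f // P f}, ∀ v, {x // last x = f.1 v} :=
    { toFun := fun τ => ⟨⟨last ∘ τ.1, τ.2⟩, fun v => ⟨τ.1 v, rfl⟩⟩
      invFun := fun p => ⟨fun v => (p.2 v).1, by
        have : (last ∘ fun v => (p.2 v).1) = p.1.1 := funext fun v => (p.2 v).2
        rw [this]; exact p.1.2⟩
      left_inv := fun τ => rfl
      right_inv := fun p => by
        obtain ⟨⟨f, hf⟩, g⟩ := p
        obtain ⟨⟨G, hG⟩, rfl⟩ : ∃ G : {G : V → X // ∀ v, last (G v) = f v},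
            g = fun v => ⟨G.1 v, G.2 v⟩ := ⟨⟨fun v => (g v).1, fun v => (g v).2⟩, rfl⟩
        obtain rfl : last ∘ G = f := funext hG
        rfl }
  have : Fintype {f : V → Ω // P f} := Fintype.ofFinite _
  rw [Nat.card_congr e, Nat.card_sigma]
  simp [Nat.card_pi, hc]

/-! ### Exit stacks and reconstruction of walks -/

section Runs

variable {V Ω : Type*} (δ : V → Ω → V)

/-- The transitions used by the automaton `δ` when it reads a word from the state `v`. -/
def transitions : V → List Ω → List (V × Ω)
  | _, [] => []
  | v, a :: s => (v, a) :: transitions (δ v a) s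

/-- One step of the walk that leaves each state `u` along the last letter of the stack `τ u`. -/
def LastStep (τ : V → List Ω) (u w : V) : Prop :=
  ∃ a, (τ u).getLast? = some a ∧ δ u a = w

variable [DecidableEq V]

/-- The stacks of letters read in each state when a word is read from the state `v`. -/
def exitStacks : V → List Ω → V → List Ω
  | _, [] => fun _ => []
  | v, a :: s => Function.update (exitStacks (δ v a) s) v (a :: exitStacks (δ v a) s v)

theorem count_exitStacks [DecidableEq Ω] (v : V) (s : List Ω) (u : V) (a : Ω) :
    (exitStacks δ v s u).count a = (transitions δ v s).count (u, a) := by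
  induction s generalizing v with
  | nil => rfl
  | cons b s ih =>
    rw [exitStacks, transitions]
    by_cases h : u = v
    · subst h
      simp [List.count_cons, ih]
    · simp [Function.update_of_ne h, ih, Ne.symm h]

/-- The top of the stack at the current state is the next letter, so the stacks replay the word. -/
theorem exitStacks_injective (v : V) : Function.Injective (exitStacks δ v) := by
  intro s t h
  induction s generalizing v t with
  | nil =>
    cases t with
    | nil => rfl
    | cons a t => simpa [exitStacks] using congrFun h v
  | cons a s ih =>
    cases t with
    | nil => simpa [exitStacks] using congrFun h v
    | cons b t =>
      have h1 := congrFun h v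
      simp only [exitStacks, Function.update_self, List.cons.injEq] at h1
      obtain ⟨rfl, h1⟩ := h1
      congr 1
      refine ih (δ v a) (funext fun u => ?_)
      by_cases hu : u = v
      · rw [hu, h1]
      · simpa [exitStacks, Function.update_of_ne hu] using congrFun h u

/-- The state entered by the last exit from `u` is either the end state or is left again later, so
following last exits moves forward in time until the end. -/
theorem reaches_of_exitStacks_ne_nil (v : V) (s : List Ω) (u : V) (hu : exitStacks δ v s u ≠ []) :
    Relation.ReflTransGen (LastStep δ (exitStacks δ v s)) u (s.foldl δ v) := by
  induction s generalizing v u with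
  | nil => simp [exitStacks] at hu
  | cons a s ih =>
    have hmono : ∀ u w, LastStep δ (exitStacks δ (δ v a) s) u w →
        LastStep δ (exitStacks δ v (a :: s)) u w := by
      rintro u w ⟨b, hb, rfl⟩
      refine ⟨b, ?_, rfl⟩
      rw [exitStacks]
      by_cases h : u = v
      · subst h
        rw [Function.update_self, List.getLast?_cons, hb]
        rfl
      · rw [Function.update_of_ne h, hb]
    by_cases hu' : exitStacks δ (δ v a) s u = []
    · by_cases h : u = v
      · subst h
        refine Relation.ReflTransGen.head (b := δ u a) ⟨a, ?_, rfl⟩ ?_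
        · simp [exitStacks, hu']
        · by_cases h2 : exitStacks δ (δ u a) s (δ u a) = []
          · cases s with
            | nil => exact Relation.ReflTransGen.refl
            | cons b s => simp [exitStacks] at h2
          · exact Relation.ReflTransGen.mono hmono _ _ (ih _ _ h2)
      · rw [exitStacks, Function.update_of_ne h] at hu
        exact absurd hu' hu
    · exact Relation.ReflTransGen.mono hmono _ _ (ih _ _ hu')

variable [Fintype V]

/-- The number of letters on the stacks `τ` that lead to the state `u`. -/
def inflow (τ : V → List Ω) (u : V) : ℕ :=
  ∑ w, (τ w).countP (fun a => δ w a = u)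

theorem inflow_update_cons (τ : V → List Ω) (v : V) (a : Ω) (l : List Ω) (u : V) :
    inflow δ (Function.update τ v (a :: l)) u =
      inflow δ (Function.update τ v l) u + if δ v a = u then 1 else 0 := by
  have h : ∀ l', inflow δ (Function.update τ v l') u = l'.countP (fun a => δ v a = u) +
      ∑ w ∈ Finset.univ.erase v, (τ w).countP (fun a => δ w a = u) := fun l' => by
    rw [inflow, ← Finset.add_sum_erase _ _ (Finset.mem_univ v), Function.update_self]
    congr 1
    exact Finset.sum_congr rfl fun w hw => by
      rw [Function.update_of_ne (Finset.ne_of_mem_erase hw)]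
  rw [h, h, List.countP_cons]
  simp only [decide_eq_true_eq]
  omega

/-- Every visit to `u` is one entry and one exit, except that the start is not entered and the end
is not left. -/
theorem inflow_exitStacks (v : V) (s : List Ω) (u : V) :
    inflow δ (exitStacks δ v s) u + (if v = u then 1 else 0) =
      (exitStacks δ v s u).length + if s.foldl δ v = u then 1 else 0 := by
  induction s generalizing v with
  | nil => rw [List.foldl_nil]; simp [inflow, exitStacks]
  | cons a s ih =>
    have := ih (δ v a)
    rw [exitStacks, inflow_update_cons, Function.update_eq_self, List.foldl_cons]
    by_cases h : u = v
    · subst h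
      simp only [Function.update_self, List.length_cons, if_true]
      omega
    · rw [Function.update_of_ne h, if_neg (Ne.symm h)]
      omega

theorem inflow_pos_of_lastStep {τ : V → List Ω} {u w : V} (h : LastStep δ τ u w) :
    0 < inflow δ τ w := by
  obtain ⟨a, ha, rfl⟩ := h
  refine lt_of_lt_of_le ?_ (Finset.single_le_sum
    (f := fun x => (τ x).countP (fun b => δ x b = δ u a)) (fun _ _ => Nat.zero_le _)
    (Finset.mem_univ u))
  exact List.countP_pos_iff.2 ⟨a, List.mem_of_getLast? ha, by simp⟩

/-- Balanced stacks whose last letters lead to `e` arise from a word read from `v` to `e`. -/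
theorem exists_exitStacks_eq (τ : V → List Ω) (v e : V)
    (hbal : ∀ u, inflow δ τ u + (if v = u then 1 else 0) =
      (τ u).length + if e = u then 1 else 0)
    (hreach : ∀ u, τ u ≠ [] → Relation.ReflTransGen (LastStep δ τ) u e) :
    ∃ s, exitStacks δ v s = τ := by
  induction hN : ∑ u, (τ u).length generalizing τ v with
  | zero =>
    refine ⟨[], funext fun u => ?_⟩
    have := (Finset.sum_eq_zero_iff.1 hN) u (Finset.mem_univ u)
    exact (List.length_eq_zero_iff.1 this).symm
  | succ N ih =>
    cases hv : τ v with
    | nil =>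
      have hb := hbal v
      rw [hv, if_pos rfl] at hb
      have hev : e = v := by
        -- An empty stack at `v` makes the right side of the balance zero unless `e = v`. Then
        -- nothing leads into `e`, so any nonempty stack would contradict reachability.
        by_contra h
        simp [h] at hb
      subst hev
      have hin : inflow δ τ e = 0 := by simpa using hb
      exfalso
      have hall : ∀ u, τ u = [] := fun u => by
        by_contra hu
        rcases Relation.ReflTransGen.cases_tail (hreach u hu) with h | ⟨w, -, hw⟩
        · exact hu (h ▸ hv)
        · exact absurd (inflow_pos_of_lastStep δ hw) (by omega)
      simp [hall] at hN
    | cons a l =>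
      have hτ : τ = Function.update (Function.update τ v l) v (a :: l) := by
        rw [Function.update_idem, ← hv, Function.update_eq_self]
      have hin : ∀ u, inflow δ τ u =
          inflow δ (Function.update τ v l) u + if δ v a = u then 1 else 0 := fun u => by
        rw [← inflow_update_cons δ τ v a l u, ← hv, Function.update_eq_self]
      have hbal' : ∀ u, inflow δ (Function.update τ v l) u + (if δ v a = u then 1 else 0) =
          (Function.update τ v l u).length + if e = u then 1 else 0 := fun u => by
        have hb := hbal u
        rw [hin u] at hb
        by_cases h : u = v
        · subst h
          rw [hv, if_pos rfl, List.length_cons] at hb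
          rw [Function.update_self]
          omega
        · rw [if_neg (Ne.symm h)] at hb
          rw [Function.update_of_ne h]
          omega
      -- Popping a letter at `v` changes the last letter only if that stack becomes empty. A last
      -- step of the popped stacks enters a state of positive inflow, which by balance has a
      -- nonempty stack or is `e`; so the old path to `e` survives.
      have hreach' : ∀ u, Relation.ReflTransGen (LastStep δ τ) u e →
          (Function.update τ v l u ≠ [] ∨ u = e) →
          Relation.ReflTransGen (LastStep δ (Function.update τ v l)) u e := fun u h => by
        induction h using Relation.ReflTransGen.head_induction_on with
        | refl => exact fun _ => Relation.ReflTransGen.refl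
        | @head u x hux hxe ihx =>
          intro hu
          by_cases hu' : Function.update τ v l u = []
          · rw [hu.resolve_left (not_not.2 hu')]
          · have hstep : LastStep δ (Function.update τ v l) u x := by
              obtain ⟨b, hb, rfl⟩ := hux
              refine ⟨b, ?_, rfl⟩
              rw [← hb]
              by_cases h : u = v
              · subst h
                rw [Function.update_self] at hu' ⊢
                rw [hv, List.getLast?_cons_of_ne_nil hu']
              · rw [Function.update_of_ne h]
            refine Relation.ReflTransGen.head hstep (ihx ?_)
            have hpos := inflow_pos_of_lastStep δ hstep
            have hb := hbal' x
            by_cases hx : x = e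
            · exact Or.inr hx
            · refine Or.inl fun h => ?_
              rw [h, if_neg (Ne.symm hx), List.length_nil] at hb
              omega
      have hN' : ∑ u, (Function.update τ v l u).length = N := by
        have h1 : ∑ u ∈ Finset.univ.erase v, (Function.update τ v l u).length =
            ∑ u ∈ Finset.univ.erase v, (τ u).length := Finset.sum_congr rfl fun u hu => by
          rw [Function.update_of_ne (Finset.ne_of_mem_erase hu)]
        have h2 := Finset.add_sum_erase Finset.univ (fun u => (τ u).length) (Finset.mem_univ v)
        rw [← Finset.add_sum_erase _ _ (Finset.mem_univ v), h1, Function.update_self]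
        simp only [hv, List.length_cons] at h2
        omega
      have hne : ∀ u, Function.update τ v l u ≠ [] → τ u ≠ [] := fun u hu h => by
        have h1 : u ≠ v := by
          rintro rfl
          simp [hv] at h
        exact hu (by rw [Function.update_of_ne h1, h])
      obtain ⟨s, hs⟩ := ih _ (δ v a) hbal'
        (fun u hu => hreach' u (hreach u (hne u hu)) (.inl hu)) hN'
      exact ⟨a :: s, by rw [exitStacks, hs, Function.update_self, ← hτ]⟩

end Runs

/-! ### Counting selections that lead to a root, by determinants -/

section Trees

variable {V : Type*} [Fintype V] [DecidableEq V]

/-- The characteristic polynomial of a nilpotent matrix is a power of `X`; evaluate it at `1`. -/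
theorem det_one_sub_eq_one_of_isNilpotent {A : Matrix V V ℚ} (h : IsNilpotent A) :
    (1 - A).det = 1 := by
  have h1 := (Matrix.isNilpotent_charpoly_sub_pow_of_isNilpotent h).eq_zero
  have h2 := Matrix.eval_charpoly A 1
  rw [sub_eq_zero.1 h1] at h2
  simpa using h2.symm

/-- The Laplacian of the functional graph of `g`, with the row of the root `r` replaced by a
row of the identity matrix. -/
def rootedLaplacian (r : V) (g : V → V) : Matrix V V ℚ :=
  fun u => Pi.single u 1 - if u = r then 0 else Pi.single (g u) 1

theorem det_rootedLaplacian_of_reaches (r : V) (g : V → V)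
    (h : ∀ u, Relation.ReflTransGen (fun u w => g u = w) u r) :
    (rootedLaplacian r g).det = 1 := by
  set A : Matrix V V ℚ := fun u => if u = r then 0 else Pi.single (g u) 1 with hA
  have hL : rootedLaplacian r g = 1 - A := by
    ext u w
    rw [Matrix.sub_apply]
    simp [rootedLaplacian, hA, Matrix.one_apply, Pi.single_apply, eq_comm]
  have hmul : ∀ (x : V → ℚ) u, A.mulVec x u = if u = r then 0 else x (g u) := fun x u => by
    by_cases hu : u = r <;> simp [Matrix.mulVec, hA, hu]
  -- Powers of `A` transport values along `g`; once the path from `u` has reached `r`, the zero row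
  -- there kills them.
  have hstep : ∀ u, ∃ i, ∀ j, i ≤ j → ∀ x : V → ℚ, (A ^ j).mulVec x u = 0 := fun u => by
    induction h u using Relation.ReflTransGen.head_induction_on with
    | refl =>
      refine ⟨1, fun j hj x => ?_⟩
      obtain ⟨j, rfl⟩ := Nat.exists_eq_add_of_le' hj
      rw [pow_succ', ← Matrix.mulVec_mulVec, hmul, if_pos rfl]
    | @head u w huw _ ih =>
      obtain ⟨i, hi⟩ := ih
      refine ⟨i + 1, fun j hj x => ?_⟩
      obtain ⟨j, rfl⟩ := Nat.exists_eq_add_of_le' (Nat.le_of_add_left_le hj)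
      rw [pow_succ', ← Matrix.mulVec_mulVec, hmul, huw, hi j (by omega), ite_self]
  choose d hd using hstep
  rw [hL]
  refine det_one_sub_eq_one_of_isNilpotent ⟨∑ u, d u, ?_⟩
  ext u w
  have := hd u (∑ u, d u) (Finset.single_le_sum (fun _ _ => Nat.zero_le _) (Finset.mem_univ u))
    (Pi.single w 1)
  simpa using this

theorem det_rootedLaplacian_of_not_reaches (r : V) (g : V → V)
    (h : ¬ ∀ u, Relation.ReflTransGen (fun u w => g u = w) u r) :
    (rootedLaplacian r g).det = 0 := by
  classical
  push Not at h
  obtain ⟨u₀, hu₀⟩ := h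
  -- The indicator of the states that do not reach `r` is a nonzero kernel vector.
  refine Matrix.exists_mulVec_eq_zero_iff.1
    ⟨fun u => if Relation.ReflTransGen (fun u w => g u = w) u r then 0 else 1,
      fun h0 => by simpa [hu₀] using congrFun h0 u₀, funext fun u => ?_⟩
  have h1 : ∀ x : V → ℚ, (rootedLaplacian r g).mulVec x u = x u - if u = r then 0 else x (g u) :=
    fun x => by
      change (Pi.single u 1 - if u = r then 0 else Pi.single (g u) 1) ⬝ᵥ x = _
      rw [sub_dotProduct]
      by_cases hu : u = r <;> simp [hu]
  rw [h1]
  by_cases hu : u = r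
  · simp [hu, Relation.ReflTransGen.refl]
  · have h2 : Relation.ReflTransGen (fun u w => g u = w) u r ↔
        Relation.ReflTransGen (fun u w => g u = w) (g u) r := by
      refine ⟨fun h => ?_, fun h => h.head rfl⟩
      rcases Relation.ReflTransGen.cases_head h with h | ⟨w, rfl, h⟩
      · exact absurd h hu
      · exact h
    simp [hu, h2]

/-- Replacing a row of `1 - P` by a row of the identity gives determinant `1 / |V|` if `P` is
doubly stochastic and all rows of some power of `P` agree. -/
theorem card_mul_det_updateRow (P : Matrix V V ℚ) (n : ℕ) (r : V)
    (hrow : ∀ u, ∑ w, P u w = 1) (hcol : ∀ w, ∑ u, P u w = 1)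
    (hn : ∀ u u' w, (P ^ n) u w = (P ^ n) u' w) :
    (Fintype.card V : ℚ) * ((1 - P).updateRow r (Pi.single r 1)).det = 1 := by
  have hN : (Fintype.card V : ℚ) ≠ 0 := by
    have : Nonempty V := ⟨r⟩
    exact_mod_cast Fintype.card_ne_zero
  set N : ℚ := (Fintype.card V : ℚ) with hNdef
  -- `J` is the uniform averaging projection. It absorbs `P` on both sides and equals `P ^ n`, so `P
  -- - J` is nilpotent.
  obtain ⟨J, hJ⟩ : ∃ J : Matrix V V ℚ, ∀ u w, J u w = 1 / N := ⟨fun _ _ => 1 / N, fun _ _ => rfl⟩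
  have hPJ : P * J = J := by
    ext u w
    simp [Matrix.mul_apply, hJ, ← Finset.sum_mul, hrow]
  have hJP : J * P = J := by
    ext u w
    simp [Matrix.mul_apply, hJ, ← Finset.mul_sum, hcol]
  have hJJ : J * J = J := by
    ext u w
    simp [Matrix.mul_apply, hJ, ← hNdef, hN]
  have hJPj : ∀ j : ℕ, J * P ^ j = J := fun j => by
    induction j with
    | zero => simp
    | succ j ih => rw [pow_succ, ← mul_assoc, ih, hJP]
  have hPn : P ^ n = J := by
    rw [← hJPj n]
    ext u w
    simp only [Matrix.mul_apply, hJ, hn _ u w]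
    simp [← hNdef, hN]
  have hpow : ∀ j : ℕ, (P - J) ^ (j + 1) = P ^ (j + 1) - J := fun j => by
    induction j with
    | zero => simp
    | succ j ih =>
      rw [pow_succ, ih, sub_mul, mul_sub, mul_sub, hJP, hJJ, ← pow_succ]
      have : P ^ (j + 1) * J = J := by
        clear ih
        induction j with
        | zero => simpa using hPJ
        | succ j ih => rw [pow_succ', mul_assoc, ih, hPJ]
      rw [this]; abel
  have hdet : (1 - (P - J)).det = 1 :=
    det_one_sub_eq_one_of_isNilpotent ⟨n + 1, by rw [hpow, pow_succ, hPn, hJP, sub_self]⟩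
  have hrow' : ∀ u, ∑ w, (1 - P) u w = 0 := fun u => by
    simp [Finset.sum_sub_distrib, hrow, Matrix.one_apply]
  have hcol' : ∀ w, ∑ u, (1 - P) u w = 0 := fun w => by
    simp [Finset.sum_sub_distrib, hcol, Matrix.one_apply]
  set D := 1 - P with hD
  set K := D.updateRow r (fun _ => 1) with hK
  set w : V → ℚ := fun u => if u = r then 0 else 1 with hw
  have hwsum : ∑ u, w u = N - 1 := by
    have : ∀ u, w u = 1 - if u = r then 1 else 0 := fun u => by
      simp only [hw]
      split_ifs <;> simp
    simp [this, Finset.sum_sub_distrib, ← hNdef]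
  -- Adding the sum of all columns to each column other than `r` turns row `r` into ones and keeps
  -- the other rows, whose sums vanish. The factor has determinant `1 + (N - 1) = N`.
  have h1 : D.updateRow r (Pi.single r 1) *
      (1 + Matrix.replicateCol Unit (1 : V → ℚ) * Matrix.replicateRow Unit w) = K := by
    ext u v
    rw [Matrix.mul_add, Matrix.mul_one, Matrix.add_apply, ← Matrix.mul_assoc]
    by_cases hu : u = r
    · subst hu
      simp [Matrix.mul_apply, hK, hw, Pi.single_apply]
      split_ifs <;> simp
    · simp [Matrix.mul_apply, hK, Matrix.updateRow_ne hu, hrow']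
  -- On the left, adding all other rows of `1 - (P - J)` to row `r` makes it all ones; on the right,
  -- `1 / N` times the row of ones is added to every other row of `K`. Both factors have determinant
  -- `1`, so `K` has determinant `1`.
  have h2 : (1 + Matrix.replicateCol Unit (Pi.single r 1 : V → ℚ) * Matrix.replicateRow Unit w) *
      (1 - (P - J)) =
      (1 + Matrix.replicateCol Unit (fun u => w u / N) *
        Matrix.replicateRow Unit (Pi.single r 1 : V → ℚ)) * K := by
    ext u v
    have hsum : ∑ x, (1 - (P - J)) x v = 1 := by
      have : ∀ x, (1 - (P - J)) x v = D x v + 1 / N := fun x => by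
        simp [hD, hJ]; ring
      simp [this, Finset.sum_add_distrib, hcol', ← hNdef, hN]
    rw [Matrix.add_mul, Matrix.one_mul, Matrix.add_apply, Matrix.add_mul, Matrix.one_mul,
      Matrix.add_apply, Matrix.mul_assoc, Matrix.mul_assoc]
    by_cases hu : u = r
    · subst hu
      rw [← Finset.add_sum_erase _ _ (Finset.mem_univ u)] at hsum
      simp [Matrix.mul_apply, hK, hw, Finset.sum_ite, Finset.filter_ne'] at hsum ⊢
      linarith
    · simp [Matrix.mul_apply, hK, hw, hu, Pi.single_apply, hD, hJ]
      ring
  have h3 := congrArg Matrix.det h1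
  have h4 := congrArg Matrix.det h2
  have e1 : w ⬝ᵥ (1 : V → ℚ) = N - 1 := by simpa only [dotProduct, Pi.one_apply, mul_one] using hwsum
  have e2 : w ⬝ᵥ (Pi.single r 1 : V → ℚ) = 0 := by simp [hw]
  have e3 : (Pi.single r 1 : V → ℚ) ⬝ᵥ (fun u => w u / N) = 0 := by simp [hw]
  rw [Matrix.det_mul, Matrix.det_one_add_replicateCol_mul_replicateRow, e1] at h3
  rw [Matrix.det_mul, Matrix.det_mul, Matrix.det_one_add_replicateCol_mul_replicateRow,
    Matrix.det_one_add_replicateCol_mul_replicateRow, hdet, ← h3, e2, e3] at h4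
  linarith

variable {Ω : Type*} [Fintype Ω] (δ : V → Ω → V)

/-- If `δ` is a regular automaton in which the state after `n` letters does not depend on the
initial state, then the functions `f` selecting one letter in each state such that all states
lead to `r` make up the fraction `1 / |V|` of all functions. -/
theorem card_mul_card_reaching [DecidableEq Ω] [Nonempty Ω] (r : V) (n : ℕ)
    (hreg : ∀ w, ∑ u, (Finset.univ.filter fun a => δ u a = w).card = Fintype.card Ω)
    (hsync : ∀ u u' (s : List Ω), s.length = n → s.foldl δ u = s.foldl δ u') :
    Fintype.card V *
      Nat.card {f : V → Ω // ∀ u, Relation.ReflTransGen (fun u w => δ u (f u) = w) u r} =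
      Fintype.card Ω ^ Fintype.card V := by
  classical
  have hq : (Fintype.card Ω : ℚ) ≠ 0 := by exact_mod_cast Fintype.card_ne_zero
  set q : ℚ := (Fintype.card Ω : ℚ) with hqdef
  obtain ⟨P, hP⟩ : ∃ P : Matrix V V ℚ, ∀ u w, P u w = (∑ a, if δ u a = w then 1 else 0) / q :=
    ⟨fun u w => (∑ a, if δ u a = w then 1 else 0) / q, fun _ _ => rfl⟩
  have hmul : ∀ (x : V → ℚ) u, P.mulVec x u = (∑ a, x (δ u a)) / q := fun x u => by
    simp only [Matrix.mulVec, dotProduct, hP, div_mul_eq_mul_div, ← Finset.sum_div, Finset.sum_mul]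
    rw [Finset.sum_comm]
    simp
  -- `P ^ j` averages `x` over the end states of all words of length `j`.
  have hpow : ∀ (j : ℕ) (x : V → ℚ) (u u' : V),
      (∀ s : List Ω, s.length = j → s.foldl δ u = s.foldl δ u') →
      (P ^ j).mulVec x u = (P ^ j).mulVec x u' := fun j x => by
    induction j with
    | zero =>
      intro u u' h
      rw [show u = u' from h [] rfl]
    | succ j ih =>
      intro u u' h
      rw [pow_succ', ← Matrix.mulVec_mulVec, hmul, hmul]
      congr 1
      exact Finset.sum_congr rfl fun a _ => ih _ _ fun s hs => h (a :: s) (by simp [hs])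
  have key := card_mul_det_updateRow P n r
    (fun u => by
      simp only [hP, ← Finset.sum_div]
      rw [Finset.sum_comm]
      simp [← hqdef, hq])
    (fun w => by
      have := congrArg (Nat.cast (R := ℚ)) (hreg w)
      simp only [hP, ← Finset.sum_div, Finset.sum_boole]
      rw [← Nat.cast_sum, this, ← hqdef, div_self hq])
    (fun u u' w => by
      simpa using hpow n (Pi.single w 1) u u' (hsync u u'))
  -- Each row is a sum over letters, so multilinearity expands the determinant over selections `f`.
  -- Row `r` is the same for every letter, matching the free choice of `f r`.
  have h1 : Matrix.det (fun u => ∑ a, (Pi.single u 1 - if u = r then 0 else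
      (Pi.single (δ u a) 1 : V → ℚ))) = ∑ f : V → Ω,
        (rootedLaplacian r fun u => δ u (f u)).det :=
    MultilinearMap.map_sum (Matrix.detRowAlternating (R := ℚ) (n := V)).toMultilinearMap
      (fun u a => (Pi.single u 1 - if u = r then 0 else (Pi.single (δ u a) 1 : V → ℚ)))
  have h2 : (fun u => ∑ a, (Pi.single u 1 - if u = r then 0 else
      (Pi.single (δ u a) 1 : V → ℚ))) =
      Matrix.of fun u w => q * ((1 - P).updateRow r (Pi.single r 1)) u w := by
    ext u w
    rw [Matrix.of_apply, Finset.sum_apply]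
    by_cases hu : u = r
    · subst hu
      simp [hqdef]
    · rw [Matrix.updateRow_ne hu, Matrix.sub_apply, hP, mul_sub, mul_div_cancel₀ _ hq]
      simp [hu, Matrix.one_apply, Pi.single_apply, hqdef, eq_comm]
  rw [h2, Matrix.det_mul_column, Finset.prod_const, Finset.card_univ] at h1
  have h3 : ∀ f : V → Ω, (rootedLaplacian r fun u => δ u (f u)).det =
      if ∀ u, Relation.ReflTransGen (fun u w => δ u (f u) = w) u r then 1 else 0 := fun f => by
    split_ifs with h
    · exact det_rootedLaplacian_of_reaches r _ h
    · exact det_rootedLaplacian_of_not_reaches r _ h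
  rw [Finset.sum_congr rfl fun f _ => h3 f, Finset.sum_boole, ← Fintype.card_subtype] at h1
  have : (Fintype.card V : ℚ) *
      (Nat.card {f : V → Ω // ∀ u, Relation.ReflTransGen (fun u w => δ u (f u) = w) u r} : ℚ) =
      q ^ Fintype.card V := by
    rw [Nat.card_eq_fintype_card, ← h1, mul_left_comm, key, mul_one]
  rw [hqdef] at this
  exact_mod_cast this

end Trees

/-! ### Counting Eulerian circuits through their stacks -/

section Balanced

variable {V Ω : Type*} [Fintype V] [DecidableEq V] [Fintype Ω] [DecidableEq Ω] (δ : V → Ω → V)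

/-- The words that use every transition exactly `m` times when read from the state `r`. -/
def balancedWords (m : ℕ) (r : V) : Set (List Ω) :=
  {s | ∀ u a, (transitions δ r s).count (u, a) = m}

theorem countP_eq_sum {Ω : Type*} [Fintype Ω] [DecidableEq Ω] (p : Ω → Prop) [DecidablePred p] (l : List Ω) :
    l.countP p = ∑ a with p a, l.count a := by
  induction l with
  | nil => simp
  | cons b l ih =>
    simp [List.countP_cons, List.count_cons, Finset.sum_add_distrib, ih]

theorem inflow_eq_of_content (m : ℕ)
    (hreg : ∀ w, ∑ u, (Finset.univ.filter fun a => δ u a = w).card = Fintype.card Ω)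
    {τ : V → List Ω} (hτ : ∀ u, τ u ∈ wordsWithContent fun _ : Ω => m) (w : V) :
    inflow δ τ w = Fintype.card Ω * m := by
  have : ∀ u, (τ u).countP (fun a => δ u a = w) =
      (Finset.univ.filter fun a => δ u a = w).card * m := fun u => by
    rw [countP_eq_sum, Finset.sum_congr rfl fun a _ => hτ u a, Finset.sum_const, smul_eq_mul]
  rw [inflow, Finset.sum_congr rfl fun u _ => this u, ← Finset.sum_mul, hreg]

theorem length_eq_of_content (m : ℕ) {l : List Ω} (hl : l ∈ wordsWithContent fun _ : Ω => m) :
    l.length = Fintype.card Ω * m := by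
  rw [length_eq_sum_count, Finset.sum_congr rfl fun a _ => hl a]
  simp

theorem exitStacks_mem_of_mem_balancedWords {V Ω : Type*} [DecidableEq V] [DecidableEq Ω]
    (δ : V → Ω → V) {m : ℕ} {r : V} {s : List Ω}
    (hs : s ∈ balancedWords δ m r) (u : V) :
    exitStacks δ r s u ∈ wordsWithContent fun _ : Ω => m := fun a => by
  rw [count_exitStacks, hs]

/-- Regularity makes inflow equal outflow at `r`, so `inflow_exitStacks` forces the walk to close.
-/
theorem foldl_eq_of_mem_balancedWords {m : ℕ} {r : V} {s : List Ω}
    (hreg : ∀ w, ∑ u, (Finset.univ.filter fun a => δ u a = w).card = Fintype.card Ω)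
    (hs : s ∈ balancedWords δ m r) : s.foldl δ r = r := by
  have hmem := exitStacks_mem_of_mem_balancedWords δ hs
  have h := inflow_exitStacks δ r s r
  rw [inflow_eq_of_content δ m hreg hmem, length_eq_of_content m (hmem r), if_pos rfl] at h
  by_contra hne
  simp [hne] at h

/-- Balanced words correspond to stacks whose last letters lead all states to `r`. -/
theorem card_balancedWords_eq {m : ℕ} (hm : 1 ≤ m) [Nonempty Ω] (r : V)
    (hreg : ∀ w, ∑ u, (Finset.univ.filter fun a => δ u a = w).card = Fintype.card Ω) :
    Nat.card (balancedWords δ m r) =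
      Nat.card {τ : V → wordsWithContent fun _ : Ω => m //
        ∀ u, Relation.ReflTransGen (LastStep δ fun v => (τ v).1) u r} := by
  have hne : ∀ {l : List Ω}, l ∈ (wordsWithContent fun _ : Ω => m) → l ≠ [] := fun h h0 => by
    obtain ⟨a, ha⟩ := getLast?_eq_of_mem_wordsWithContent hm (Classical.arbitrary Ω) h
    simp [h0] at ha
  refine Nat.card_congr (Equiv.ofBijective (fun s =>
    ⟨fun u => ⟨exitStacks δ r s.1 u, exitStacks_mem_of_mem_balancedWords δ s.2 u⟩, fun u => ?_⟩)
      ⟨fun s t h => ?_, fun τ => ?_⟩)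
  · have := reaches_of_exitStacks_ne_nil δ r s.1 u
      (hne (exitStacks_mem_of_mem_balancedWords δ s.2 u))
    rwa [foldl_eq_of_mem_balancedWords δ hreg s.2] at this
  · refine Subtype.ext (exitStacks_injective δ r (funext fun u => ?_))
    exact congrArg Subtype.val (congrFun (congrArg Subtype.val h) u)
  · obtain ⟨τ, hτ⟩ := τ
    obtain ⟨s, hs⟩ := exists_exitStacks_eq δ (fun u => (τ u).1) r r
      (fun u => by
        rw [inflow_eq_of_content δ m hreg (fun u => (τ u).2), length_eq_of_content m (τ u).2])
      (fun u _ => hτ u)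
    refine ⟨⟨s, fun u a => ?_⟩, ?_⟩
    · rw [← count_exitStacks, hs]
      exact (τ u).2 a
    · exact Subtype.ext (funext fun u => Subtype.ext (congrFun hs u))

theorem card_mul_card_balancedWords {m : ℕ} (hm : 1 ≤ m) [Nonempty Ω] (r : V) (n : ℕ)
    (hreg : ∀ w, ∑ u, (Finset.univ.filter fun a => δ u a = w).card = Fintype.card Ω)
    (hsync : ∀ u u' (s : List Ω), s.length = n → s.foldl δ u = s.foldl δ u') :
    Fintype.card V * Nat.card (balancedWords δ m r) =
      Nat.card (wordsWithContent fun _ : Ω => m) ^ Fintype.card V := by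
  have : Finite (wordsWithContent fun _ : Ω => m) := finite_wordsWithContent _
  choose last hlast using fun x : wordsWithContent fun _ : Ω => m =>
    getLast?_eq_of_mem_wordsWithContent hm (Classical.arbitrary Ω) x.2
  have hfib : ∀ a, Nat.card {x // last x = a} =
      Nat.card {l : wordsWithContent fun _ : Ω => m // l.1.getLast? = some a} := fun a =>
    Nat.card_congr (Equiv.subtypeEquivRight fun x => by simp [hlast])
  obtain ⟨c, hc⟩ : ∃ c, ∀ a, Nat.card {x // last x = a} = c :=
    ⟨_, fun a => (hfib a).trans ((card_getLast?_eq_card_getLast? m a (Classical.arbitrary Ω)))⟩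
  -- The `|Ω|` fibres of `last` all have size `c`, so the powers of `c` cancel against the count of
  -- selections.
  have hqc : Nat.card (wordsWithContent fun _ : Ω => m) = Fintype.card Ω * c := by
    rw [← Nat.card_congr (Equiv.sigmaFiberEquiv last), Nat.card_sigma,
      Finset.sum_congr rfl fun a _ => hc a]
    simp
  have h1 := card_comp_mul_pow (V := V) last c hc
    (fun f => ∀ u, Relation.ReflTransGen (fun u w => δ u (f u) = w) u r)
  rw [card_balancedWords_eq δ hm r hreg, hqc, mul_pow, ← card_mul_card_reaching δ r n hreg hsync,
    mul_assoc, ← h1]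
  congr 1
  refine Nat.card_congr (Equiv.subtypeEquivRight fun τ => ?_)
  have : LastStep δ (fun v => (τ v).1) = fun u w => δ u ((last ∘ τ) u) = w := by
    funext u w
    simp [LastStep, hlast]
  rw [this]

end Balanced

/-! ### The de Bruijn automaton -/

section Shift

variable {Ω : Type*}

/-- The transition function of the de Bruijn automaton: append a letter, drop the first one. -/
def shift {n : ℕ} (u : Fin n → Ω) (a : Ω) : Fin n → Ω :=
  fun j => (Fin.snoc u a : Fin (n + 1) → Ω) j.succ

theorem shift_apply_of_lt {n : ℕ} (u : Fin n → Ω) (a : Ω) (j : Fin n) (h : j.val + 1 < n) :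
    shift u a j = u ⟨j.val + 1, h⟩ := by
  simp [shift, Fin.snoc, h, Fin.castLT]

theorem shift_apply_of_not_lt {n : ℕ} (u : Fin n → Ω) (a : Ω) (j : Fin n)
    (h : ¬ j.val + 1 < n) : shift u a j = a := by
  simp [shift, Fin.snoc, h]

/-- A disagreement confined to the first `i` places is confined to the first `i - 1` after one more
letter. -/
theorem foldl_shift_eq_of_agree {n : ℕ} (s : List Ω) (i : ℕ) (u u' : Fin n → Ω)
    (h : ∀ j : Fin n, i ≤ j.val → u j = u' j) (j : Fin n) (hj : i ≤ j.val + s.length) :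
    s.foldl shift u j = s.foldl shift u' j := by
  induction s generalizing i u u' with
  | nil => exact h j hj
  | cons a s ih =>
    refine ih (i - 1) _ _ (fun l hl => ?_) (by simp at hj; omega)
    by_cases hl' : l.val + 1 < n
    · rw [shift_apply_of_lt _ _ _ hl', shift_apply_of_lt _ _ _ hl']
      exact h _ (by simp; omega)
    · rw [shift_apply_of_not_lt _ _ _ hl', shift_apply_of_not_lt _ _ _ hl']

theorem foldl_shift_eq {n : ℕ} (u u' : Fin n → Ω) (s : List Ω) (hs : s.length = n) :
    s.foldl shift u = s.foldl shift u' :=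
  funext fun j => foldl_shift_eq_of_agree s n u u' (fun l hl => absurd l.isLt (by omega)) j
    (by omega)

/-- A transition into `w` is determined by the letter it drops, and that letter is arbitrary. -/
theorem sum_card_shift_eq [Fintype Ω] [DecidableEq Ω] {n : ℕ} (w : Fin n → Ω) :
    ∑ u : Fin n → Ω, (Finset.univ.filter fun a => shift u a = w).card = Fintype.card Ω := by
  have hbij : Function.Bijective (fun p : Σ u : Fin n → Ω, {a // shift u a = w} =>
      (Fin.snoc p.1 p.2.1 : Fin (n + 1) → Ω) 0) := by
    refine ⟨fun p p' h => ?_, fun b => ⟨⟨Fin.init (Fin.cons b w : Fin (n + 1) → Ω),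
      (Fin.cons b w : Fin (n + 1) → Ω) (Fin.last n), ?_⟩, ?_⟩⟩
    · obtain ⟨u, a, ha⟩ := p
      obtain ⟨u', a', ha'⟩ := p'
      have h1 : (Fin.snoc u a : Fin (n + 1) → Ω) = Fin.snoc u' a' := by
        funext j
        refine Fin.cases h (fun j => ?_) j
        exact congrFun (ha.trans ha'.symm) j
      obtain ⟨rfl, rfl⟩ := Fin.snoc_inj.1 h1
      rfl
    · funext j
      rw [shift, Fin.snoc_init_self, Fin.cons_succ]
    · simp only [Fin.snoc_init_self, Fin.cons_zero]
  rw [← Fintype.card_of_bijective hbij, Fintype.card_sigma]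
  simp [Fintype.card_subtype]

theorem transitions_shift {n : ℕ} (x : ℕ → Ω) (ℓ : ℕ) :
    transitions shift (fun j : Fin n => x j) ((List.range ℓ).map fun i => x (i + n)) =
      (List.range ℓ).map fun i => (fun j : Fin n => x (i + j), x (i + n)) := by
  induction ℓ generalizing x with
  | zero => rfl
  | succ ℓ ih =>
    have h : shift (fun j : Fin n => x j) (x n) = fun j : Fin n => x (j + 1) := by
      funext j
      by_cases hj : j.val + 1 < n
      · rw [shift_apply_of_lt _ _ _ hj]
      · rw [shift_apply_of_not_lt _ _ _ hj]
        congr 1; omega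
    have := ih fun i => x (i + 1)
    rw [List.range_succ_eq_map]
    simp only [List.map_cons, List.map_map, transitions, Nat.zero_add, h]
    refine congrArg₂ _ rfl ?_
    convert this using 2
    · refine List.map_congr_left fun i _ => ?_
      simp only [Function.comp]
      congr 1; omega
    · funext i
      simp only [Function.comp, Prod.mk.injEq]
      refine ⟨funext fun j => ?_, ?_⟩ <;> congr 1 <;> omega

theorem foldl_shift {n : ℕ} (x : ℕ → Ω) (ℓ : ℕ) :
    ((List.range ℓ).map fun i => x (i + n)).foldl shift (fun j : Fin n => x j) =
      fun j : Fin n => x (ℓ + j) := by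
  induction ℓ with
  | zero => simp
  | succ ℓ ih =>
    rw [List.range_succ, List.map_append, List.foldl_append, ih]
    funext j
    simp only [List.map_cons, List.map_nil, List.foldl_cons, List.foldl_nil]
    by_cases hj : j.val + 1 < n
    · rw [shift_apply_of_lt _ _ _ hj]
      congr 1; simp only; omega
    · rw [shift_apply_of_not_lt _ _ _ hj]
      congr 1; omega

end Shift

/-! ### Linearizations as closed walks -/

section Linearizations

variable {Ω : Type*}

theorem exists_periodic_extension (t : List Ω) (ht : 0 < t.length) :
    ∃ x : ℕ → Ω, ∀ i, x i = t[i % t.length]'(Nat.mod_lt _ ht) :=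
  ⟨_, fun _ => rfl⟩

theorem rotate_eq_map_range (t : List Ω) (ht : 0 < t.length) (x : ℕ → Ω)
    (hx : ∀ i, x i = t[i % t.length]'(Nat.mod_lt _ ht)) (n : ℕ) :
    t.rotate n = (List.range t.length).map fun i => x (i + n) := by
  refine List.ext_getElem (by simp) fun i h1 h2 => ?_
  simp [List.getElem_rotate, hx]

variable [DecidableEq Ω]

theorem mem_linearizedSeqs_iff {m k : ℕ} {s : List Ω} :
    s ∈ linearizedSeqs Ω m k ↔ ∀ y : Fin k → Ω, listCount y s = m := by
  constructor
  · rintro ⟨c, hc, rfl⟩ y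
    exact hc y
  · exact fun h => ⟨(s : Cycle Ω), fun y => h y, rfl⟩

/-- The transition at time `i` pairs the `n` letters from position `i` with the letter after them.
Rotation by `n` is needed because the first `n` letters form the initial state. -/
theorem listCount_eq_count_transitions {n : ℕ} (t : List Ω) (ht : 0 < t.length)
    (u : Fin n → Ω) (a : Ω) :
    listCount (Fin.snoc u a : Fin (n + 1) → Ω) t =
      (transitions shift (cyclicKmer t n ⟨0, ht⟩) (t.rotate n)).count (u, a) := by
  obtain ⟨x, hx⟩ := exists_periodic_extension t ht
  have h0 : cyclicKmer t n ⟨0, ht⟩ = fun j : Fin n => x j := by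
    funext j
    simp [cyclicKmer, hx]
  rw [rotate_eq_map_range t ht x hx, h0, transitions_shift, List.count_eq_countP,
    List.countP_map, listCount]
  have h1 : ∀ i : Fin t.length, cyclicKmer t (n + 1) i = (Fin.snoc u a : Fin (n + 1) → Ω) ↔
      ((fun j : Fin n => x (i.val + j)), x (i.val + n)) = (u, a) := fun i => by
    have h2 : cyclicKmer t (n + 1) i =
        (Fin.snoc (fun j : Fin n => x (i.val + j)) (x (i.val + n)) : Fin (n + 1) → Ω) := by
      funext j
      refine Fin.lastCases ?_ (fun j => ?_) j
      · simp [cyclicKmer, hx]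
      · simp [cyclicKmer, hx]
    rw [h2, Fin.snoc_inj, Prod.mk.injEq]
  simp only [h1]
  rw [Finset.card_filter, Fin.sum_univ_eq_sum_range (fun i =>
    if ((fun j : Fin n => x (i + j)), x (i + n)) = (u, a) then 1 else 0), ← Finset.card_filter,
    List.countP_eq_length_filter]
  simp [Finset.card_def, Finset.range, Multiset.range, Function.comp_def]
  rfl

theorem exists_rotate_eq_of_foldl_eq {Ω : Type*} {n : ℕ} (r : Fin n → Ω) (s : List Ω) (hs : 0 < s.length)
    (h : s.foldl shift r = r) :
    ∃ t : List Ω, t.rotate n = s ∧ ∃ ht : 0 < t.length, cyclicKmer t n ⟨0, ht⟩ = r := by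
  obtain ⟨x, hx⟩ : ∃ x : ℕ → Ω, (∀ j : Fin n, x j = r j) ∧
      ∀ i (hi : i < s.length), x (i + n) = s[i] := by
    -- `x` is `r` followed by `s`; the default `s[0]` is reached only from index `s.length + n` on,
    -- where `x` is never used.
    refine ⟨fun i => if h : i < n then r ⟨i, h⟩ else s.getD (i - n) s[0], fun j => ?_,
      fun i hi => ?_⟩
    · simp
    · simp [hi]
  obtain ⟨hxr, hxs⟩ := hx
  have hr : (fun j : Fin n => x j) = r := funext hxr
  have hs' : s = (List.range s.length).map fun i => x (i + n) :=
    List.ext_getElem (by simp) fun i h1 h2 => by simp [hxs i h1]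
  have hper : ∀ j : Fin n, x (s.length + j) = x j := fun j => by
    have h1 := foldl_shift (n := n) x s.length
    rw [← hs', hr, h] at h1
    rw [hxr j, h1]
  -- Strong induction is needed because `n` may exceed `s.length`, so that `r` wraps around several
  -- times.
  have hmod : ∀ i, i < s.length + n → x (i % s.length) = x i := fun i => by
    induction i using Nat.strong_induction_on with
    | _ i ih =>
      intro hi
      by_cases hlt : i < s.length
      · rw [Nat.mod_eq_of_lt hlt]
      · have h1 := ih (i - s.length) (by omega) (by omega)
        have h2 := hper ⟨i - s.length, by omega⟩
        simp only [show s.length + (i - s.length) = i by omega] at h2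
        rw [Nat.mod_eq_sub_mod (by omega), h1, h2]
  refine ⟨(List.range s.length).map x, ?_, by simpa using hs, ?_⟩
  · refine List.ext_getElem (by simp) fun i h1 h2 => ?_
    simp only [List.getElem_rotate, List.length_map, List.length_range, List.getElem_map,
      List.getElem_range]
    rw [hmod _ (by omega), hxs i h2]
  · funext j
    simp only [cyclicKmer, List.length_map, List.length_range, List.getElem_map,
      List.getElem_range, Nat.zero_add]
    rw [hmod _ (by omega), hxr j]

variable [Fintype Ω]

theorem sum_listCount (k : ℕ) (s : List Ω) :
    ∑ y : Fin k → Ω, listCount y s = s.length := by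
  simp only [listCount]
  rw [← Finset.card_eq_sum_card_fiberwise (fun _ _ => Finset.mem_coe.2 (Finset.mem_univ _))]
  simp

theorem length_eq_of_mem_linearizedSeqs {m k : ℕ} {s : List Ω} (hs : s ∈ linearizedSeqs Ω m k) :
    s.length = Fintype.card Ω ^ k * m := by
  rw [← sum_listCount k, Finset.sum_congr rfl fun y _ => mem_linearizedSeqs_iff.1 hs y]
  simp

theorem finite_linearizedSeqs (m k : ℕ) : (linearizedSeqs Ω m k).Finite :=
  (List.finite_length_eq Ω _).subset fun _ hs => length_eq_of_mem_linearizedSeqs hs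

end Linearizations

/-! ### Assembling the count -/

section Count

variable {Ω : Type*} [Fintype Ω] [DecidableEq Ω]

theorem length_pos_of_mem_linearizedSeqs [Nonempty Ω] {m k : ℕ} (hm : 1 ≤ m) {s : List Ω}
    (hs : s ∈ linearizedSeqs Ω m k) : 0 < s.length := by
  rw [length_eq_of_mem_linearizedSeqs hs]
  exact Nat.mul_pos (pow_pos Fintype.card_pos k) hm

theorem mem_linearizedSeqs_iff_rotate_mem_balancedWords {Ω : Type*} [DecidableEq Ω]
    {m n : ℕ} (t : List Ω) (ht : 0 < t.length) :
    t ∈ linearizedSeqs Ω m (n + 1) ↔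
      t.rotate n ∈ balancedWords shift m (cyclicKmer t n ⟨0, ht⟩) := by
  rw [mem_linearizedSeqs_iff]
  constructor
  · intro h u a
    rw [← listCount_eq_count_transitions, h]
  · intro h y
    rw [← Fin.snoc_init_self y, listCount_eq_count_transitions t ht, h]

/-- Linearizations that start with an `n`-mer `r` correspond to balanced words read from `r`. -/
theorem card_linearizedSeqs_fiber [Nonempty Ω] {m : ℕ} (hm : 1 ≤ m) (n : ℕ) (r : Fin n → Ω) :
    Nat.card {t : linearizedSeqs Ω m (n + 1) //
        cyclicKmer t.1 n ⟨0, length_pos_of_mem_linearizedSeqs hm t.2⟩ = r} =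
      Nat.card (balancedWords shift m r) := by
  refine Nat.card_congr (Equiv.ofBijective (fun t => ⟨t.1.1.rotate n, ?_⟩)
    ⟨fun t t' h => ?_, fun s => ?_⟩)
  · have h := (mem_linearizedSeqs_iff_rotate_mem_balancedWords t.1.1
      (length_pos_of_mem_linearizedSeqs hm t.1.2)).1 t.1.2
    rwa [t.2] at h
  · exact Subtype.ext (Subtype.ext (List.rotate_injective n (congrArg Subtype.val h)))
  · obtain ⟨s, hs⟩ := s
    have hpos : 0 < s.length := by
      rw [List.length_pos_iff]
      rintro rfl
      have := hs r (Classical.arbitrary Ω)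
      simp [transitions] at this
      omega
    obtain ⟨t, rfl, ht, hr⟩ := exists_rotate_eq_of_foldl_eq r s hpos
      (foldl_eq_of_mem_balancedWords shift sum_card_shift_eq hs)
    have hmem : t ∈ linearizedSeqs Ω m (n + 1) := by
      rw [mem_linearizedSeqs_iff_rotate_mem_balancedWords t ht, hr]
      exact hs
    exact ⟨⟨⟨t, hmem⟩, hr⟩, rfl⟩

theorem card_linearizedSeqs [Nonempty Ω] {m : ℕ} (hm : 1 ≤ m) (n : ℕ) :
    Nat.card (linearizedSeqs Ω m (n + 1)) =
      Nat.card (wordsWithContent fun _ : Ω => m) ^ Fintype.card Ω ^ n := by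
  have : Finite (linearizedSeqs Ω m (n + 1)) := finite_linearizedSeqs m (n + 1)
  have hV : Fintype.card (Fin n → Ω) = Fintype.card Ω ^ n := by simp
  have hB := fun r : Fin n → Ω => card_mul_card_balancedWords shift hm r n
    sum_card_shift_eq foldl_shift_eq
  have hr₀ := hB fun _ => Classical.arbitrary Ω
  -- By `hB`, `|V|` times the number of circuits is independent of `r`, so summing over the `|V|`
  -- fibres cancels the factor `1 / |V|`.
  have hconst : ∀ r : Fin n → Ω, Nat.card (balancedWords shift m r) =
      Nat.card (balancedWords shift m fun _ : Fin n => Classical.arbitrary Ω) := fun r =>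
    Nat.eq_of_mul_eq_mul_left Fintype.card_pos ((hB r).trans hr₀.symm)
  rw [← hV, ← hr₀, ← Nat.card_congr (Equiv.sigmaFiberEquiv
      fun t : linearizedSeqs Ω m (n + 1) =>
        cyclicKmer t.1 n ⟨0, length_pos_of_mem_linearizedSeqs hm t.2⟩), Nat.card_sigma,
    Finset.sum_congr rfl fun r _ => (card_linearizedSeqs_fiber hm n r).trans (hconst r),
    Finset.sum_const, Finset.card_univ, smul_eq_mul]

theorem startsWith_rotate_iff {Ω : Type*} {k : ℕ} (y : Fin k → Ω) (t : List Ω) (i : Fin t.length) :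
    StartsWith (t.rotate i) y ↔ cyclicKmer t k i = y := by
  have h : ∀ h : 0 < (t.rotate i).length, cyclicKmer (t.rotate i) k ⟨0, h⟩ = cyclicKmer t k i :=
    fun h => by
      funext j
      simp [cyclicKmer, List.getElem_rotate, add_comm]
  exact ⟨fun ⟨h0, h1⟩ => (h h0).symm.trans h1,
    fun h1 => ⟨by simpa using i.pos, (h _).trans h1⟩⟩

theorem rotate_mem_linearizedSeqs_iff {Ω : Type*} [DecidableEq Ω] {m k : ℕ} (t : List Ω) (i : ℕ) :
    t.rotate i ∈ linearizedSeqs Ω m k ↔ t ∈ linearizedSeqs Ω m k := by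
  simp only [mem_linearizedSeqs_iff]
  exact forall_congr' fun y => by
    rw [listCount_eq_of_isRotated y (List.IsRotated.symm ⟨i, rfl⟩)]

/-- Double counting of pairs `(t, i)` such that `t.rotate i` starts with `y`: each `t` has `m` such
`i`, and for each of the `|Ω| ^ k * m` values of `i`, rotation by `i` permutes the linearizations.
-/
theorem card_mul_ncard_linearizedSeqsFrom {m k : ℕ} (hm : 1 ≤ m) (y : Fin k → Ω) :
    Fintype.card Ω ^ k * (linearizedSeqsFrom m k y).ncard = Nat.card (linearizedSeqs Ω m k) := by
  classical
  have hfin := finite_linearizedSeqs (Ω := Ω) m k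
  set N := Fintype.card Ω ^ k * m with hN
  set L := hfin.toFinset with hL
  have hmem : ∀ t, t ∈ L ↔ t ∈ linearizedSeqs Ω m k := fun t => by simp [hL]
  have hlen : ∀ t ∈ L, t.length = N := fun t ht =>
    length_eq_of_mem_linearizedSeqs ((hmem t).1 ht)
  have hy : (linearizedSeqsFrom m k y).ncard = (L.filter fun t => StartsWith t y).card := by
    rw [← Set.ncard_coe_finset]
    congr 1
    ext t
    simp [linearizedSeqsFrom, hmem]
  have h1 : ∀ t ∈ L, ((Finset.range N).filter fun i => StartsWith (t.rotate i) y).card = m :=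
    fun t ht => by
      rw [← mem_linearizedSeqs_iff.1 ((hmem t).1 ht) y, listCount, Finset.card_filter,
        Finset.card_filter, ← hlen t ht, ← Fin.sum_univ_eq_sum_range
          (fun i => if StartsWith (t.rotate i) y then 1 else 0)]
      exact Finset.sum_congr rfl fun i _ => by simp only [startsWith_rotate_iff]
  have h2 : ∀ i ∈ Finset.range N, (L.filter fun t => StartsWith (t.rotate i) y).card =
      (L.filter fun t => StartsWith t y).card := fun i hi => by
    refine Finset.card_bij (fun t _ => t.rotate i) (fun t ht => ?_)
      (fun t _ t' _ h => List.rotate_injective i h) fun s hs => ?_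
    · simp only [Finset.mem_filter, hmem, rotate_mem_linearizedSeqs_iff] at ht ⊢
      exact ht
    · have hrot : (s.rotate (N - i)).rotate i = s := by
        rw [List.rotate_rotate, Nat.sub_add_cancel (Finset.mem_range.1 hi).le,
          ← hlen s (Finset.mem_filter.1 hs).1, List.rotate_length]
      refine ⟨s.rotate (N - i), ?_, hrot⟩
      simp only [Finset.mem_filter, hmem, rotate_mem_linearizedSeqs_iff, hrot] at hs ⊢
      exact hs
  have h3 : L.card * m = N * (L.filter fun t => StartsWith t y).card := by
    have := Finset.sum_card_bipartiteAbove_eq_sum_card_bipartiteBelow (s := L)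
      (t := Finset.range N) (fun t i => StartsWith (t.rotate i) y)
    simp only [Finset.bipartiteAbove, Finset.bipartiteBelow] at this
    rw [Finset.sum_congr rfl h1, Finset.sum_congr rfl h2] at this
    simpa using this
  have hcard : Nat.card (linearizedSeqs Ω m k) = L.card := by
    rw [Nat.card_coe_set_eq, Set.ncard_eq_toFinset_card _ hfin]
  rw [hcard, hy]
  refine Nat.eq_of_mul_eq_mul_right hm ?_
  rw [h3, hN]
  ring

theorem cast_card_wordsWithContent_const (m : ℕ) :
    (Nat.card (wordsWithContent fun _ : Ω => m) : ℚ) =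
      ((m * Fintype.card Ω).factorial : ℚ) / (m.factorial : ℚ) ^ Fintype.card Ω := by
  have h := card_wordsWithContent_mul fun _ : Ω => m
  simp only [Finset.prod_const, Finset.sum_const, Finset.card_univ, smul_eq_mul] at h
  rw [eq_div_iff (pow_ne_zero _ (by exact_mod_cast m.factorial_ne_zero)), mul_comm m]
  exact_mod_cast h

end Count

end MultiDeBruijn

theorem mainTheorem2 {Ω : Type*} [Fintype Ω] [DecidableEq Ω] (m q k : ℕ)
    (hΩ : Fintype.card Ω = q) (hm : 1 ≤ m) (hk : 1 ≤ k) (y : Fin k → Ω) :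
    (MultiDeBruijn.linearizedSeqsFrom m k y).Finite ∧
      ((MultiDeBruijn.linearizedSeqsFrom m k y).ncard : ℚ)
        = MultiDeBruijn.W m q k / (q : ℚ) ^ k := by
  refine ⟨(MultiDeBruijn.finite_linearizedSeqs m k).subset fun s hs => hs.1, ?_⟩
  obtain ⟨n, rfl⟩ := Nat.exists_eq_add_of_le' hk
  have : Nonempty Ω := ⟨y 0⟩
  subst hΩ
  have hq : (Fintype.card Ω : ℚ) ≠ 0 := by exact_mod_cast Fintype.card_ne_zero
  have h := MultiDeBruijn.card_mul_ncard_linearizedSeqsFrom hm y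
  rw [MultiDeBruijn.card_linearizedSeqs hm n] at h
  rw [eq_div_iff (pow_ne_zero _ hq), MultiDeBruijn.W, Nat.add_sub_cancel,
    ← MultiDeBruijn.cast_card_wordsWithContent_const, mul_comm]
  exact_mod_cast h
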